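/- A $3$-graph $H$ on a finite vertex set $V(H)$ is a set of $3$-element subsets (edges) of $V(H)$; $|H|$ is its number of edges. For a $2$-set $S\subseteq V(H)$ let $d(S)$ be the number of edges containing $S$, and let $\delta_2(H)$ and $\Delta_2(H)$ be the minimum and the maximum of $d(S)$ over all $2$-sets $S$. A perfect matching of $H$ is a set of pairwise disjoint edges covering $V(H)$. Let $\tau_H:(\mathbb{R}^{V(H)})^3\to\mathbb{R}$ be the trilinear form with $\tau_H(e_u,e_v,e_w)=1$ if $\{u,v,w\}\in H$ and $0$ otherwise, on standard basis vectors, and let $J$ be the trilinear form with $J(e_u,e_v,e_w)=1$ for all $u,v,w\in V(H)$. For a trilinear form $\varphi$ put $\|\varphi\|=\sup\{|\varphi(x,y,z)| : \|x\|_2=\|y\|_2=\|z\|_2=1\}$. For an $n$-vertex $3$-graph $H$ define $$\lambda_1(H)=\|\tau_H\|,\qquad \lambda_2(H)=\Big\|\tau_H-\frac{6|H|}{n^3}J\Big\|.$$ Statement. For every $\alpha>0$ there exist $n_0$ and $\gamma>0$, depending only on $\alpha$, such that the following holds. Let $H$ be an $n$-vertex $3$-graph with at least one edge, where $3\mid n$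 and $n\ge n_0$. Let $p=|H|/\binom{n}{3}$ and assume that $\delta_2(H)\ge\alpha pn$, $\Delta_2(H)\le\frac1\alpha pn$, and $$\lambda_2(H)\le\gamma p^{15}\lambda_1(H).$$ Then $H$ contains a perfect matching. -/

import Mathlib

/-- A `k`-graph (`k`-uniform hypergraph) on the vertex set `V`. -/
structure KGraph (V : Type*) (k : ℕ) where
  /-- The edge set. -/
  edges : Finset (Finset V)
  /-- Every edge has exactly `k` vertices. -/
  uniform : ∀ e ∈ edges, e.card = k

namespace KGraph

/-- The degree `d(S)`: the number of edges that contain the vertex set `S`. -/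
def degree
    {V : Type*} [DecidableEq V] {k : ℕ} (H : KGraph V k) (S : Finset V) : ℕ :=
  (H.edges.filter fun e => S ⊆ e).card

/-- `δ_ℓ(H)`: the minimum of `d(S)` over all `ℓ`-sets `S` of vertices. -/
noncomputable def minDegree
    {V : Type*} [DecidableEq V] {k : ℕ} (H : KGraph V k) (l : ℕ) : ℕ :=
  sInf {d | ∃ S : Finset V, S.card = l ∧ H.degree S = d}

/-- `Δ_ℓ(H)`: the maximum of `d(S)` over all `ℓ`-sets `S` of vertices. -/
def maxDegree
    {V : Type*} [Fintype V] [DecidableEq V] {k : ℕ} (H : KGraph V k) (l : ℕ) : ℕ :=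
  (Finset.univ.powersetCard l).sup H.degree

/-- A perfect matching: pairwise disjoint edges that cover every vertex. -/
def HasPerfectMatching
    {V : Type*} {k : ℕ} (H : KGraph V k) : Prop :=
  ∃ M : Finset (Finset V), M ⊆ H.edges ∧
    (∀ e ∈ M, ∀ f ∈ M, e ≠ f → Disjoint e f) ∧ ∀ v : V, ∃ e ∈ M, v ∈ e

/-- The `k`-linear form on `ℝ^V` whose value at the standard basis vectors
`(e_{v 0}, …, e_{v (k-1)})` is `a v`. -/
noncomputable def formOfCoeff
    {V : Type*} [Fintype V] {k : ℕ} (a : (Fin k → V) → ℝ) :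
    MultilinearMap ℝ (fun _ : Fin k => EuclideanSpace ℝ V) ℝ :=
  ∑ v : Fin k → V, a v •
    (MultilinearMap.mkPiAlgebra ℝ (Fin k) ℝ).compLinearMap
      (fun i => (EuclideanSpace.proj (v i) : EuclideanSpace ℝ V →L[ℝ] ℝ).toLinearMap)

theorem formOfCoeff_apply {V : Type*} [Fintype V] {k : ℕ} (a : (Fin k → V) → ℝ)
    (x : Fin k → EuclideanSpace ℝ V) :
    formOfCoeff a x = ∑ v : Fin k → V, a v * ∏ i, x i (v i) := by
  simp [formOfCoeff]

/-- The adjacency map `τ_H`: it sends `(e_{v_1}, …, e_{v_k})` to `1` if `{v_1, …, v_k}` is an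
edge of `H`, and to `0` otherwise. -/
noncomputable def adjForm
    {V : Type*} [Fintype V] [DecidableEq V] {k : ℕ} (H : KGraph V k) :
    MultilinearMap ℝ (fun _ : Fin k => EuclideanSpace ℝ V) ℝ :=
  formOfCoeff fun v => if Finset.univ.image v ∈ H.edges then 1 else 0

/-- The all-ones map `J`: it sends every `k`-tuple of standard basis vectors to `1`. -/
noncomputable def allOnesForm (V : Type*) [Fintype V] (k : ℕ) :
    MultilinearMap ℝ (fun _ : Fin k => EuclideanSpace ℝ V) ℝ :=
  formOfCoeff fun _ => 1

/-- The spectral norm of a `k`-linear form: the supremum of `|φ(x_1, …, x_k)|` over Euclidean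
unit vectors `x_1, …, x_k`. -/
noncomputable def formNorm
    {V : Type*} [Fintype V] {k : ℕ}
    (φ : MultilinearMap ℝ (fun _ : Fin k => EuclideanSpace ℝ V) ℝ) : ℝ :=
  sSup {r | ∃ x : Fin k → EuclideanSpace ℝ V, (∀ i, ‖x i‖ = 1) ∧ r = |φ x|}

/-- The set in the definition of the spectral norm is bounded above. -/
theorem formNorm_bddAbove {V : Type*} [Fintype V] {k : ℕ}
    (φ : MultilinearMap ℝ (fun _ : Fin k => EuclideanSpace ℝ V) ℝ) :
    BddAbove {r | ∃ x : Fin k → EuclideanSpace ℝ V, (∀ i, ‖x i‖ = 1) ∧ r = |φ x|} := by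
  classical
  let b := EuclideanSpace.basisFun V ℝ
  refine ⟨∑ v : Fin k → V, |φ fun i => b (v i)|, ?_⟩
  rintro r ⟨x, hx, rfl⟩
  have h : φ x = ∑ v : Fin k → V, (∏ i, x i (v i)) * φ fun i => b (v i) := by
    have hx' : x = fun i => ∑ w : V, x i w • b w := by
      funext i
      exact ((b.sum_repr (x i)).symm.trans (by simp [b]))
    conv_lhs => rw [hx']
    rw [MultilinearMap.map_sum]
    exact Finset.sum_congr rfl fun v _ => by rw [MultilinearMap.map_smul_univ, smul_eq_mul]
  rw [h]
  refine (Finset.abs_sum_le_sum_abs _ _).trans (Finset.sum_le_sum fun v _ => ?_)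
  rw [abs_mul, Finset.abs_prod]
  refine mul_le_of_le_one_left (abs_nonneg _)
    (Finset.prod_le_one (fun _ _ => abs_nonneg _) fun i _ => ?_)
  have := PiLp.norm_apply_le (x i) (v i)
  rwa [hx i, Real.norm_eq_abs] at this

/-- The largest eigenvalue `λ_1(H) = λ_{1,1+⋯+1}(H)`. -/
noncomputable def eigOne
    {V : Type*} [Fintype V] [DecidableEq V] {k : ℕ} (H : KGraph V k) : ℝ :=
  formNorm H.adjForm

/-- The second largest eigenvalue `λ_2(H) = λ_{2,1+⋯+1}(H)`: the spectral norm of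
`τ_H - (k! |H| / n^k) J`. -/
noncomputable def eigTwo
    {V : Type*} [Fintype V] [DecidableEq V] {k : ℕ} (H : KGraph V k) : ℝ :=
  formNorm (H.adjForm -
    ((k.factorial : ℝ) * (H.edges.card : ℝ) / (Fintype.card V : ℝ) ^ k) • allOnesForm V k)

end KGraph

/-! Let `M` be a maximum matching, `U` the set of vertices it misses, and q = 6|H|/n³. Since `U` is
independent, testing τ − qJ on the indicator vector of `U` gives q|U|³ ≤ λ₂|U|^{3/2}, which forces
|U| ≤ αpn/4 (`density_mul_card_pow_le`). If `U` is nonempty, divisibility by 3 provides three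
uncovered vertices, and six edges of `M` can be traded for seven edges of `H`, a contradiction.

In the trade each uncovered vertex takes one vertex from each of two of the six edges. The two
vertices left in each of the six edges are absorbed by four edges arranged as a Pasch configuration:
six points, four lines, two lines through each point, any two lines meeting once. The points are the
six matching edges, and the two lines through a point use different vertices of that edge, so the
four new edges are disjoint.

Such a trade exists by counting. The codegree bound gives each uncovered vertex at least αpn²/2
ordered pairs of covered vertices. Because two lines of the Pasch configuration share only one
point, λ₂ controls its count: the main term is q⁴(αpn²/2)³ and the error is at most 4n³ · λ₂n^{3/2}
(`le_sum_pasch`). At most 90n⁵ choices repeat a matching edge. Since λ₂ ≥ 1/2 (`half_le_eigTwo`) and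
λ₁ ≤ n^{3/2}, the spectral hypothesis also makes p⁷n large, so the main term, of order p⁷n⁶, wins
(`matching_numerics`). -/

open Finset

/-! ### Spectral estimates: test vectors for τ − qJ. -/

namespace KGraph

variable {V : Type*} [Fintype V]

theorem abs_form_le_formNorm {k : ℕ}
    (φ : MultilinearMap ℝ (fun _ : Fin k => EuclideanSpace ℝ V) ℝ)
    (x : Fin k → EuclideanSpace ℝ V) : |φ x| ≤ formNorm φ * ∏ i, ‖x i‖ := by
  by_cases h : ∃ i, x i = 0
  · obtain ⟨i, hi⟩ := h
    rw [φ.map_coord_zero i hi, Finset.prod_eq_zero (mem_univ i) (by simp [hi])]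
    simp
  · push Not at h
    have hx : x = fun i => ‖x i‖ • (‖x i‖⁻¹ • x i) := by
      funext i
      rw [smul_smul, mul_inv_cancel₀ (norm_ne_zero_iff.2 (h i)), one_smul]
    have hle : |φ fun i => ‖x i‖⁻¹ • x i| ≤ formNorm φ := by
      refine le_csSup (formNorm_bddAbove φ) ⟨_, fun i => ?_, rfl⟩
      rw [norm_smul, norm_inv, norm_norm, inv_mul_cancel₀ (norm_ne_zero_iff.2 (h i))]
    conv_lhs => rw [hx]
    rw [MultilinearMap.map_smul_univ, smul_eq_mul, abs_mul, mul_comm,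
      abs_of_nonneg (Finset.prod_nonneg fun i _ => norm_nonneg (x i))]
    exact mul_le_mul_of_nonneg_right hle (Finset.prod_nonneg fun i _ => norm_nonneg (x i))

theorem sum_abs_le_sqrt_card_mul_norm (x : EuclideanSpace ℝ V) :
    ∑ v, |x v| ≤ √(Fintype.card V) * ‖x‖ := by
  rw [EuclideanSpace.norm_eq, ← Real.sqrt_mul (Nat.cast_nonneg _)]
  refine Real.le_sqrt_of_sq_le ?_
  simpa using sq_sum_le_card_mul_sum_sq (s := univ) (f := fun v => |x v|)

theorem norm_le_sqrt_card {x : EuclideanSpace ℝ V} (hx : ∀ v, |x v| ≤ 1) :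
    ‖x‖ ≤ √(Fintype.card V) := by
  rw [EuclideanSpace.norm_eq]
  refine Real.sqrt_le_sqrt ?_
  calc ∑ v, ‖x v‖ ^ 2 ≤ ∑ _v : V, (1 : ℝ) :=
        sum_le_sum fun v _ => pow_le_one₀ (norm_nonneg _) (hx v)
    _ = _ := by simp

theorem formNorm_formOfCoeff_le {k : ℕ} {a : (Fin k → V) → ℝ} (ha : ∀ v, |a v| ≤ 1) :
    formNorm (formOfCoeff a) ≤ √(Fintype.card V) ^ k := by
  refine Real.sSup_le ?_ (by positivity)
  rintro r ⟨x, hx, rfl⟩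
  rw [formOfCoeff_apply]
  calc |∑ v : Fin k → V, a v * ∏ i, x i (v i)|
      ≤ ∑ v : Fin k → V, ∏ i, |x i (v i)| := by
        refine (abs_sum_le_sum_abs _ _).trans (sum_le_sum fun v _ => ?_)
        rw [abs_mul, abs_prod]
        exact mul_le_of_le_one_left (prod_nonneg fun _ _ => abs_nonneg _) (ha v)
    _ = ∏ i, ∑ v, |x i v| := by
        rw [Finset.prod_univ_sum, Fintype.piFinset_univ]
    _ ≤ ∏ _i : Fin k, √(Fintype.card V) := by
        refine prod_le_prod (fun i _ => sum_nonneg fun _ _ => abs_nonneg _) fun i _ => ?_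
        simpa [hx i] using sum_abs_le_sqrt_card_mul_norm (x i)
    _ = _ := by simp

variable [DecidableEq V]

/-- The `0`-`1` indicator of the edges of a `3`-graph. -/
def indicator (H : KGraph V 3) (u v w : V) : ℝ := if {u, v, w} ∈ H.edges then 1 else 0

omit [Fintype V] in
theorem indicator_nonneg (H : KGraph V 3) (u v w : V) : 0 ≤ H.indicator u v w := by
  unfold indicator; split_ifs <;> norm_num

omit [Fintype V] in
theorem indicator_le_one (H : KGraph V 3) (u v w : V) : H.indicator u v w ≤ 1 := by
  unfold indicator; split_ifs <;> norm_num

omit [Fintype V] in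
theorem mem_edges_of_indicator_ne_zero {H : KGraph V 3} {u v w : V}
    (h : H.indicator u v w ≠ 0) : {u, v, w} ∈ H.edges := by
  unfold indicator at h
  by_contra h'
  exact h (if_neg h')

/-- The ordered edge density `6 |H| / n ^ 3`. -/
noncomputable def density (H : KGraph V 3) : ℝ :=
  ((3 : ℕ).factorial : ℝ) * (H.edges.card : ℝ) / (Fintype.card V : ℝ) ^ 3

theorem deviation_form_apply (H : KGraph V 3) (x y z : EuclideanSpace ℝ V) :
    (H.adjForm - H.density • allOnesForm V 3) ![x, y, z] =
      ∑ u, ∑ v, ∑ w, (H.indicator u v w - H.density) * (x u * y v * z w) := by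
  have key : ∀ F : (Fin 3 → V) → ℝ, ∑ s, F s = ∑ u, ∑ v, ∑ w, F ![u, v, w] := fun F => by
    rw [← Equiv.sum_comp (Fin.consEquiv fun _ => V), Fintype.sum_prod_type]
    refine sum_congr rfl fun u _ => ?_
    rw [← Equiv.sum_comp (finTwoArrowEquiv V).symm, Fintype.sum_prod_type]
    rfl
  rw [_root_.sub_apply, _root_.smul_apply, adjForm, allOnesForm,
    formOfCoeff_apply, formOfCoeff_apply, smul_eq_mul, mul_sum, ← sum_sub_distrib, key]
  refine sum_congr rfl fun u _ => sum_congr rfl fun v _ => sum_congr rfl fun w _ => ?_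
  have : Finset.univ.image ![u, v, w] = {u, v, w} := by
    ext a; simp [Fin.exists_fin_succ, eq_comm]
  simp only [this, indicator, Fin.prod_univ_three, Matrix.cons_val]
  ring

theorem abs_deviation_sum_le (H : KGraph V 3) (x y z : EuclideanSpace ℝ V) :
    |∑ u, ∑ v, ∑ w, (H.indicator u v w - H.density) * (x u * y v * z w)| ≤
      H.eigTwo * (‖x‖ * ‖y‖ * ‖z‖) := by
  rw [← deviation_form_apply]
  have h := abs_form_le_formNorm (H.adjForm - H.density • allOnesForm V 3) ![x, y, z]
  rw [Fin.prod_univ_three] at h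
  exact h

theorem eigTwo_nonneg (H : KGraph V 3) : 0 ≤ H.eigTwo := by
  refine Real.sSup_nonneg ?_
  rintro r ⟨x, -, rfl⟩
  exact abs_nonneg _

theorem eigOne_le (H : KGraph V 3) : H.eigOne ≤ √(Fintype.card V) ^ 3 := by
  refine formNorm_formOfCoeff_le fun v => ?_
  split_ifs <;> norm_num

theorem abs_indicator_sub_density_le_eigTwo (H : KGraph V 3) (u v w : V) :
    |H.indicator u v w - H.density| ≤ H.eigTwo := by
  simpa [Pi.single_apply] using abs_deviation_sum_le H (EuclideanSpace.single u 1)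
    (EuclideanSpace.single v 1) (EuclideanSpace.single w 1)

/-- The coefficient of τ − qJ is 1 − q at an edge and −q at a constant triple, and λ₂ bounds both in
absolute value. This is what turns the spectral hypothesis into a lower bound on p. -/
theorem half_le_eigTwo {H : KGraph V 3} (h : H.edges.Nonempty) : 1 / 2 ≤ H.eigTwo := by
  obtain ⟨e, he⟩ := h
  obtain ⟨u, v, w, -, -, -, rfl⟩ := card_eq_three.1 (H.uniform e he)
  have h1 := abs_indicator_sub_density_le_eigTwo H u v w
  have h2 := abs_indicator_sub_density_le_eigTwo H u u u
  have hu : ({u, u, u} : Finset V) ∉ H.edges := fun h => by simpa using H.uniform _ h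
  rw [indicator, if_pos he] at h1
  rw [indicator, if_neg hu] at h2
  have h3 := (abs_le.1 h1).2
  have h4 := (abs_le.1 h2).1
  linarith

/-- A bound for the size of an independent set. -/
theorem density_mul_card_pow_le {H : KGraph V 3} {U : Finset V}
    (hU : ∀ e ∈ H.edges, ¬ e ⊆ U) :
    H.density ^ 2 * (U.card : ℝ) ^ 3 ≤ H.eigTwo ^ 2 := by
  let x : EuclideanSpace ℝ V := WithLp.toLp 2 fun v => if v ∈ U then 1 else 0
  have hx : ‖x‖ = √U.card := by
    rw [EuclideanSpace.norm_eq]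
    congr 1
    simp [x, apply_ite abs, ite_pow]
  have hs : ∑ u, ∑ v, ∑ w, (H.indicator u v w - H.density) * (x u * x v * x w) =
      - (H.density * (U.card : ℝ) ^ 3) := by
    have h1 : ∀ u v w, (H.indicator u v w - H.density) * (x u * x v * x w) =
        - H.density * (x u * (x v * x w)) := fun u v w => by
      by_cases h : u ∈ U ∧ v ∈ U ∧ w ∈ U
      · have : ({u, v, w} : Finset V) ∉ H.edges := fun h' => hU _ h' (by
          intro a; simp only [mem_insert, mem_singleton]; rintro (rfl | rfl | rfl) <;> tauto)
        rw [indicator, if_neg this]; ring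
      · have : x u * (x v * x w) = 0 := by
          simp only [x]
          split_ifs <;> simp_all
        rw [mul_assoc (x u), this]; ring
    have h2 : ∑ u, x u = (U.card : ℝ) := by simp [x]
    simp only [h1, ← mul_sum, h2, ← sum_mul]
    ring
  have h := abs_deviation_sum_le H x x x
  rw [hs, abs_neg, hx] at h
  have hq : 0 ≤ H.density := by unfold density; positivity
  rw [abs_of_nonneg (by positivity)] at h
  set s := √(U.card : ℝ) with hs'
  have hs0 : 0 ≤ s := Real.sqrt_nonneg _
  have hc : (U.card : ℝ) = s ^ 2 := (Real.sq_sqrt (Nat.cast_nonneg _)).symm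
  rw [hc] at h ⊢
  rcases hs0.eq_or_lt with h0 | h0
  · rw [← h0]; simpa using sq_nonneg _
  · have h' : H.density * s ^ 3 ≤ H.eigTwo := by
      have : (H.density * s ^ 3) * s ^ 3 ≤ H.eigTwo * s ^ 3 := by
        calc _ = H.density * (s ^ 2) ^ 3 := by ring
          _ ≤ _ := h
          _ = _ := by ring
      exact le_of_mul_le_mul_right this (pow_pos h0 3)
    calc _ = (H.density * s ^ 3) ^ 2 := by ring
      _ ≤ _ := pow_le_pow_left₀ (mul_nonneg hq (pow_nonneg hs0 3)) h' 2

/-- Extending the weights by zero along the injections gives vectors of norm at most √n. The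
injections may differ because a matching edge contributes different vertices to different new edges.
-/
theorem abs_deviation_sum_comp_le {T : Type*} [Fintype T] (H : KGraph V 3)
    {ρ₁ ρ₂ ρ₃ : T → V} (h₁ : ρ₁.Injective) (h₂ : ρ₂.Injective) (h₃ : ρ₃.Injective)
    {f g h : T → ℝ} (hf : ∀ a, |f a| ≤ 1) (hg : ∀ a, |g a| ≤ 1) (hh : ∀ a, |h a| ≤ 1) :
    |∑ a, ∑ b, ∑ c, (H.indicator (ρ₁ a) (ρ₂ b) (ρ₃ c) - H.density) * (f a * g b * h c)| ≤
      H.eigTwo * √(Fintype.card V) ^ 3 := by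
  have push : ∀ {ρ : T → V}, ρ.Injective → ∀ (f : T → ℝ) (F : V → ℝ),
      ∑ v, F v * Function.extend ρ f 0 v = ∑ a, F (ρ a) * f a := fun {ρ} hρ f F => by
    rw [← sum_subset (subset_univ (univ.image ρ)), sum_image hρ.injOn]
    · exact sum_congr rfl fun a _ => by rw [hρ.extend_apply]
    · intro v _ hv
      rw [Function.extend_apply', Pi.zero_apply, mul_zero]
      simpa using hv
  have bound : ∀ {ρ : T → V}, ρ.Injective → ∀ {f : T → ℝ}, (∀ a, |f a| ≤ 1) →
      ‖(WithLp.toLp 2 (Function.extend ρ f 0) : EuclideanSpace ℝ V)‖ ≤ √(Fintype.card V) :=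
    fun {ρ} hρ {f} hf => norm_le_sqrt_card fun v => by
      by_cases hv : ∃ a, ρ a = v
      · obtain ⟨a, rfl⟩ := hv
        exact (congrArg abs (hρ.extend_apply f 0 a)).trans_le (hf a)
      · simp [Function.extend_apply' _ _ _ hv]
  have key := abs_deviation_sum_le H (WithLp.toLp 2 (Function.extend ρ₁ f 0))
    (WithLp.toLp 2 (Function.extend ρ₂ g 0)) (WithLp.toLp 2 (Function.extend ρ₃ h 0))
  simp only [← mul_assoc, push h₃] at key
  have comm : ∀ u, ∑ v, ∑ c, (H.indicator u v (ρ₃ c) - H.density) *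
      Function.extend ρ₁ f 0 u * Function.extend ρ₂ g 0 v * h c =
      (∑ b, ∑ c, (H.indicator u (ρ₂ b) (ρ₃ c) - H.density) * (g b * h c)) *
        Function.extend ρ₁ f 0 u := fun u => by
    calc _ = ∑ v, (∑ c, (H.indicator u v (ρ₃ c) - H.density) *
          Function.extend ρ₁ f 0 u * h c) * Function.extend ρ₂ g 0 v := by
          refine sum_congr rfl fun v _ => ?_
          rw [sum_mul]
          exact sum_congr rfl fun c _ => by ring
      _ = _ := by
          rw [push h₂, sum_mul]
          refine sum_congr rfl fun b _ => ?_
          rw [sum_mul, sum_mul]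
          exact sum_congr rfl fun c _ => by ring
  simp only [comm, push h₁] at key
  have heq : ∑ a, ∑ b, ∑ c, (H.indicator (ρ₁ a) (ρ₂ b) (ρ₃ c) - H.density) * (f a * g b * h c) =
      ∑ a, (∑ b, ∑ c, (H.indicator (ρ₁ a) (ρ₂ b) (ρ₃ c) - H.density) * (g b * h c)) * f a := by
    refine sum_congr rfl fun a _ => ?_
    rw [sum_mul]
    refine sum_congr rfl fun b _ => ?_
    rw [sum_mul]
    exact sum_congr rfl fun c _ => by ring
  rw [heq]
  refine key.trans ?_
  have := eigTwo_nonneg H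
  rw [mul_assoc, mul_assoc, pow_three]
  gcongr
  exacts [bound h₁ hf, bound h₂ hg, bound h₃ hh]

end KGraph

/-! ### Counting Pasch configurations. -/

section PaschCounting

variable {T : Type*} [Fintype T]

/-- Fix the second point of each pair. Each of the other three lines then contains just one free
point, so the weight on `A - q` is a product of three functions of one variable each and `hA`
applies. The fixed points account for the factor |T|³. -/
theorem abs_sum_pasch_sub_le {A B C D : T → T → T → ℝ} {L₁ L₂ L₃ : T → T → ℝ} {q E : ℝ}
    (hA : ∀ f g h : T → ℝ, (∀ a, |f a| ≤ 1) → (∀ a, |g a| ≤ 1) → (∀ a, |h a| ≤ 1) →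
      |∑ a, ∑ b, ∑ c, (A a b c - q) * (f a * g b * h c)| ≤ E)
    (hB : ∀ a b c, |B a b c| ≤ 1) (hC : ∀ a b c, |C a b c| ≤ 1) (hD : ∀ a b c, |D a b c| ≤ 1)
    (h₁ : ∀ a b, |L₁ a b| ≤ 1) (h₂ : ∀ a b, |L₂ a b| ≤ 1) (h₃ : ∀ a b, |L₃ a b| ≤ 1) :
    |∑ x : T × T, ∑ y : T × T, ∑ z : T × T, L₁ x.1 x.2 * L₂ y.1 y.2 * L₃ z.1 z.2 *
      ((A x.1 y.1 z.1 - q) * B x.1 y.2 z.2 * C x.2 y.1 z.2 * D x.2 y.2 z.1)| ≤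
      (Fintype.card T : ℝ) ^ 3 * E := by
  have heq : ∑ x : T × T, ∑ y : T × T, ∑ z : T × T, L₁ x.1 x.2 * L₂ y.1 y.2 * L₃ z.1 z.2 *
      ((A x.1 y.1 z.1 - q) * B x.1 y.2 z.2 * C x.2 y.1 z.2 * D x.2 y.2 z.1) =
      ∑ b₁, ∑ b₂, ∑ b₃, ∑ a₁, ∑ a₂, ∑ a₃, (A a₁ a₂ a₃ - q) *
        ((L₁ a₁ b₁ * B a₁ b₂ b₃) * (L₂ a₂ b₂ * C b₁ a₂ b₃) * (L₃ a₃ b₃ * D b₁ b₂ a₃)) := by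
    simp only [Fintype.sum_prod_type_right]
    refine sum_congr rfl fun b₁ _ => ?_
    rw [sum_comm]
    refine sum_congr rfl fun b₂ _ => ?_
    refine (sum_congr rfl fun a₁ _ => sum_comm).trans ?_
    rw [sum_comm]
    refine sum_congr rfl fun b₃ _ => sum_congr rfl fun a₁ _ => sum_congr rfl fun a₂ _ =>
      sum_congr rfl fun a₃ _ => by ring
  have mul_le : ∀ {s t : ℝ}, |s| ≤ 1 → |t| ≤ 1 → |s * t| ≤ 1 := fun hs ht => by
    rw [abs_mul]; exact mul_le_one₀ hs (abs_nonneg _) ht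
  rw [heq]
  calc _ ≤ ∑ _b₁ : T, ∑ _b₂ : T, ∑ _b₃ : T, E := by
        refine (abs_sum_le_sum_abs _ _).trans (sum_le_sum fun b₁ _ => ?_)
        refine (abs_sum_le_sum_abs _ _).trans (sum_le_sum fun b₂ _ => ?_)
        refine (abs_sum_le_sum_abs _ _).trans (sum_le_sum fun b₃ _ => ?_)
        exact hA (fun a => L₁ a b₁ * B a b₂ b₃) (fun a => L₂ a b₂ * C b₁ a b₃)
          (fun a => L₃ a b₃ * D b₁ b₂ a) (fun a => mul_le (h₁ _ _) (hB _ _ _))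
          (fun a => mul_le (h₂ _ _) (hC _ _ _)) (fun a => mul_le (h₃ _ _) (hD _ _ _))
    _ = _ := by simp only [sum_const, card_univ, nsmul_eq_mul]; ring

/-- Counting copies of the Pasch configuration whose three pairs of non-collinear points are edges
of the graphs `L₁`, `L₂`, `L₃`. -/
theorem le_sum_pasch {A B C D : T → T → T → ℝ} {L₁ L₂ L₃ : T → T → ℝ} {q E : ℝ}
    (hq : |q| ≤ 1)
    (hA : ∀ f g h : T → ℝ, (∀ a, |f a| ≤ 1) → (∀ a, |g a| ≤ 1) → (∀ a, |h a| ≤ 1) →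
      |∑ a, ∑ b, ∑ c, (A a b c - q) * (f a * g b * h c)| ≤ E)
    (hB : ∀ f g h : T → ℝ, (∀ a, |f a| ≤ 1) → (∀ a, |g a| ≤ 1) → (∀ a, |h a| ≤ 1) →
      |∑ a, ∑ b, ∑ c, (B a b c - q) * (f a * g b * h c)| ≤ E)
    (hC : ∀ f g h : T → ℝ, (∀ a, |f a| ≤ 1) → (∀ a, |g a| ≤ 1) → (∀ a, |h a| ≤ 1) →
      |∑ a, ∑ b, ∑ c, (C a b c - q) * (f a * g b * h c)| ≤ E)
    (hD : ∀ f g h : T → ℝ, (∀ a, |f a| ≤ 1) → (∀ a, |g a| ≤ 1) → (∀ a, |h a| ≤ 1) →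
      |∑ a, ∑ b, ∑ c, (D a b c - q) * (f a * g b * h c)| ≤ E)
    (hB' : ∀ a b c, |B a b c| ≤ 1) (hC' : ∀ a b c, |C a b c| ≤ 1) (hD' : ∀ a b c, |D a b c| ≤ 1)
    (h₁ : ∀ a b, |L₁ a b| ≤ 1) (h₂ : ∀ a b, |L₂ a b| ≤ 1) (h₃ : ∀ a b, |L₃ a b| ≤ 1) :
    q ^ 4 * ((∑ a, ∑ b, L₁ a b) * (∑ a, ∑ b, L₂ a b) * (∑ a, ∑ b, L₃ a b)) -
        4 * ((Fintype.card T : ℝ) ^ 3 * E) ≤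
      ∑ x : T × T, ∑ y : T × T, ∑ z : T × T, L₁ x.1 x.2 * L₂ y.1 y.2 * L₃ z.1 z.2 *
        (A x.1 y.1 z.1 * B x.1 y.2 z.2 * C x.2 y.1 z.2 * D x.2 y.2 z.1) := by
  have swap : ∀ F : T × T → ℝ, ∑ x : T × T, F x = ∑ x : T × T, F (x.2, x.1) := fun F =>
    ((Equiv.prodComm T T).sum_comp F).symm
  -- Telescope ABCD − q⁴ = (A−q)BCD + q(B−q)CD + q²(C−q)D + q³(D−q). Swapping the ends of two of the
  -- three pairs is a symmetry of the configuration; it moves `B`, `C` or `D` into the place of `A`,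
  -- hence the transposed graphs.
  have eA := abs_sum_pasch_sub_le hA hB' hC' hD' h₁ h₂ h₃
  have eB := abs_sum_pasch_sub_le (A := B) (B := fun _ _ _ => q) (C := fun a b c => D a b c)
    (D := fun a b c => C a b c) (L₁ := L₁) (L₂ := fun a b => L₂ b a) (L₃ := fun a b => L₃ b a)
    hB (fun _ _ _ => hq) hD' hC' h₁ (fun a b => h₂ b a) (fun a b => h₃ b a)
  have eC := abs_sum_pasch_sub_le (A := C) (B := D) (C := fun _ _ _ => q)
    (D := fun _ _ _ => q) (L₁ := fun a b => L₁ b a) (L₂ := L₂) (L₃ := fun a b => L₃ b a)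
    hC hD' (fun _ _ _ => hq) (fun _ _ _ => hq) (fun a b => h₁ b a) h₂
    (fun a b => h₃ b a)
  have eD := abs_sum_pasch_sub_le (A := D) (B := fun _ _ _ => q) (C := fun _ _ _ => q)
    (D := fun _ _ _ => q) (L₁ := fun a b => L₁ b a) (L₂ := fun a b => L₂ b a) (L₃ := L₃)
    hD (fun _ _ _ => hq) (fun _ _ _ => hq) (fun _ _ _ => hq) (fun a b => h₁ b a)
    (fun a b => h₂ b a) h₃
  have sB : ∀ G : T × T → T × T → T × T → ℝ, ∑ x : T × T, ∑ y : T × T, ∑ z : T × T, G x y z =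
      ∑ x : T × T, ∑ y : T × T, ∑ z : T × T, G x (y.2, y.1) (z.2, z.1) := fun G =>
    sum_congr rfl fun x _ => (swap _).trans (sum_congr rfl fun y _ => swap _)
  have sC : ∀ G : T × T → T × T → T × T → ℝ, ∑ x : T × T, ∑ y : T × T, ∑ z : T × T, G x y z =
      ∑ x : T × T, ∑ y : T × T, ∑ z : T × T, G (x.2, x.1) y (z.2, z.1) := fun G =>
    (swap _).trans (sum_congr rfl fun x _ => sum_congr rfl fun y _ => swap _)
  have sD : ∀ G : T × T → T × T → T × T → ℝ, ∑ x : T × T, ∑ y : T × T, ∑ z : T × T, G x y z =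
      ∑ x : T × T, ∑ y : T × T, ∑ z : T × T, G (x.2, x.1) (y.2, y.1) z := fun G =>
    (swap _).trans (sum_congr rfl fun x _ => swap _)
  rw [sB] at eB
  rw [sC] at eC
  rw [sD] at eD
  have main : q ^ 4 * ((∑ a, ∑ b, L₁ a b) * (∑ a, ∑ b, L₂ a b) * (∑ a, ∑ b, L₃ a b)) =
      ∑ x : T × T, ∑ y : T × T, ∑ z : T × T, L₁ x.1 x.2 * L₂ y.1 y.2 * L₃ z.1 z.2 * q ^ 4 := by
    simp only [← sum_mul, ← mul_sum, Fintype.sum_prod_type]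
    ring
  rw [main]
  have e := add_le_add (add_le_add (add_le_add (abs_le.1 eA).1 (abs_le.1 eB).1)
    (abs_le.1 eC).1) (abs_le.1 eD).1
  simp only [← sum_add_distrib] at e
  have tele : ∑ x : T × T, ∑ y : T × T, ∑ z : T × T, L₁ x.1 x.2 * L₂ y.1 y.2 * L₃ z.1 z.2 *
        (A x.1 y.1 z.1 * B x.1 y.2 z.2 * C x.2 y.1 z.2 * D x.2 y.2 z.1) -
      ∑ x : T × T, ∑ y : T × T, ∑ z : T × T, L₁ x.1 x.2 * L₂ y.1 y.2 * L₃ z.1 z.2 * q ^ 4 ≥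
      -((Fintype.card T : ℝ) ^ 3 * E) + -((Fintype.card T : ℝ) ^ 3 * E) +
        -((Fintype.card T : ℝ) ^ 3 * E) + -((Fintype.card T : ℝ) ^ 3 * E) := by
    simp only [← sum_sub_distrib]
    refine e.trans_eq ?_
    refine sum_congr rfl fun x _ => sum_congr rfl fun y _ => sum_congr rfl fun z _ => by ring
  linarith

end PaschCounting

/-! ### Degenerate sextuples. -/

/-- A coincidence at positions i ≠ j leaves only the `Fin 3` coordinate of `s i` free. There are 30
ordered pairs (i, j), and 90 = 30 · 3. -/
theorem card_not_injective_fst_le (ι : Type*) [Fintype ι] [DecidableEq ι] :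
    (univ.filter fun s : Fin 6 → ι × Fin 3 => ¬ Function.Injective fun i => (s i).1).card ≤
      90 * Fintype.card (ι × Fin 3) ^ 5 := by
  have hsub : (univ.filter fun s : Fin 6 → ι × Fin 3 =>
      ¬ Function.Injective fun i => (s i).1) ⊆
      (univ.filter fun ij : Fin 6 × Fin 6 => ij.1 ≠ ij.2).biUnion fun ij =>
        univ.filter fun s : Fin 6 → ι × Fin 3 => (s ij.1).1 = (s ij.2).1 := by
    intro s hs
    simp only [mem_filter, mem_univ, true_and, Function.Injective, not_forall] at hs
    obtain ⟨i, j, h, hij⟩ := hs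
    simp only [mem_biUnion, mem_filter, mem_univ, true_and]
    exact ⟨(i, j), hij, h⟩
  have hpair : ∀ ij ∈ univ.filter fun ij : Fin 6 × Fin 6 => ij.1 ≠ ij.2,
      (univ.filter fun s : Fin 6 → ι × Fin 3 => (s ij.1).1 = (s ij.2).1).card ≤
        3 * Fintype.card (ι × Fin 3) ^ 5 := by
    rintro ⟨i, j⟩ hij
    simp only [mem_filter, mem_univ, true_and] at hij
    rw [← Fintype.card_subtype]
    let φ : {s : Fin 6 → ι × Fin 3 // (s i).1 = (s j).1} →
        Fin 3 × ({k : Fin 6 // k ≠ i} → ι × Fin 3) := fun s => ((s.1 i).2, fun k => s.1 k)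
    have hφ : φ.Injective := by
      rintro ⟨s, hs⟩ ⟨t, ht⟩ h
      simp only [φ, Prod.mk.injEq, funext_iff] at h
      ext1
      funext k
      by_cases hk : k = i
      · subst hk
        have := h.2 ⟨j, hij.symm⟩
        exact Prod.ext (by rw [hs, ht]; exact congrArg Prod.fst this) h.1
      · exact h.2 ⟨k, hk⟩
    refine (Fintype.card_le_of_injective φ hφ).trans_eq ?_
    have : Fintype.card {k : Fin 6 // k ≠ i} = 5 := by simp
    rw [Fintype.card_prod, Fintype.card_fun, this, Fintype.card_fin]
  refine (card_le_card hsub).trans ((card_biUnion_le_card_mul _ _ _ hpair).trans_eq ?_)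
  have : (univ.filter fun ij : Fin 6 × Fin 6 => ij.1 ≠ ij.2).card = 30 := by decide
  rw [this]; ring

theorem exists_injective_fst_of_lt_sum {ι : Type*} [Fintype ι] [DecidableEq ι]
    {w : (ι × Fin 3) × (ι × Fin 3) → (ι × Fin 3) × (ι × Fin 3) →
      (ι × Fin 3) × (ι × Fin 3) → ℝ} (hw : ∀ x y z, w x y z ≤ 1)
    (h : 90 * (Fintype.card (ι × Fin 3) : ℝ) ^ 5 < ∑ x, ∑ y, ∑ z, w x y z) :
    ∃ x y z, w x y z ≠ 0 ∧
      Function.Injective fun i => (![x.1, x.2, y.1, y.2, z.1, z.2] i).1 := by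
  by_contra! hcon
  let vec : ((ι × Fin 3) × (ι × Fin 3)) × ((ι × Fin 3) × (ι × Fin 3)) ×
      ((ι × Fin 3) × (ι × Fin 3)) → Fin 6 → ι × Fin 3 :=
    fun x => ![x.1.1, x.1.2, x.2.1.1, x.2.1.2, x.2.2.1, x.2.2.2]
  have hvec : vec.Injective := by
    rintro ⟨⟨a, b⟩, ⟨c, d⟩, ⟨e, f⟩⟩ ⟨⟨a', b'⟩, ⟨c', d'⟩, ⟨e', f'⟩⟩ h
    have h0 := congrFun h 0
    have h1 := congrFun h 1
    have h2 := congrFun h 2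
    have h3 := congrFun h 3
    have h4 := congrFun h 4
    have h5 := congrFun h 5
    simp only [vec, Matrix.cons_val] at h0 h1 h2 h3 h4 h5
    subst h0 h1 h2 h3 h4 h5
    rfl
  refine h.not_ge ?_
  calc ∑ x, ∑ y, ∑ z, w x y z = ∑ x : ((ι × Fin 3) × (ι × Fin 3)) ×
        ((ι × Fin 3) × (ι × Fin 3)) × ((ι × Fin 3) × (ι × Fin 3)), w x.1 x.2.1 x.2.2 := by
        simp only [Fintype.sum_prod_type (α₁ := (ι × Fin 3) × (ι × Fin 3))]
    _ ≤ ∑ x, if ¬ Function.Injective fun i => (vec x i).1 then (1 : ℝ) else 0 := by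
        refine sum_le_sum fun x _ => ?_
        split_ifs with hx
        · by_contra! h0
          exact hcon _ _ _ h0.ne' (not_not.1 (by simpa [vec] using hx))
        · exact hw _ _ _
    _ = ((univ.filter fun x => ¬ Function.Injective fun i => (vec x i).1).card : ℝ) := by
        rw [sum_boole]
    _ ≤ ((univ.filter fun s : Fin 6 → ι × Fin 3 =>
        ¬ Function.Injective fun i => (s i).1).card : ℝ) := by
        refine Nat.cast_le.2 (card_le_card_of_injOn vec ?_ hvec.injOn)
        intro x hx
        simpa using hx
    _ ≤ _ := by exact_mod_cast card_not_injective_fst_le ι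

/-! ### Matchings and the six-for-seven exchange. -/

namespace KGraph

/-- A matching: a set of pairwise disjoint edges. -/
def IsMatching {V : Type*} {k : ℕ} (H : KGraph V k) (M : Finset (Finset V)) : Prop :=
  M ⊆ H.edges ∧ ∀ e ∈ M, ∀ f ∈ M, e ≠ f → Disjoint e f

variable {V : Type*} [DecidableEq V]

/-- Exchanging part of a matching for edges that avoid the remaining part. -/
theorem IsMatching.exists_exchange {k : ℕ} {H : KGraph V k} {M M₀ N : Finset (Finset V)}
    (hk : k ≠ 0) (hM : H.IsMatching M) (h₀ : M₀ ⊆ M) (hN : H.IsMatching N)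
    (hd : ∀ e ∈ N, ∀ f ∈ M, f ∉ M₀ → Disjoint e f) :
    ∃ M', H.IsMatching M' ∧ M'.card + M₀.card = M.card + N.card := by
  refine ⟨(M \ M₀) ∪ N, ⟨union_subset (sdiff_subset.trans hM.1) hN.1, ?_⟩, ?_⟩
  · intro e he f hf hef
    simp only [mem_union, mem_sdiff] at he hf
    rcases he with he | he <;> rcases hf with hf | hf
    · exact hM.2 e he.1 f hf.1 hef
    · exact (hd f hf e he.1 he.2).symm
    · exact hd e he f hf.1 hf.2
    · exact hN.2 e he f hf hef
  -- An edge in both families would be disjoint from itself, hence empty; `hk` excludes this.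
  · have hdis : Disjoint (M \ M₀) N := by
      rw [Finset.disjoint_left]
      intro e he heN
      rw [mem_sdiff] at he
      have h := hd e heN e he.1 he.2
      rw [disjoint_self, bot_eq_empty] at h
      have := H.uniform e (hN.1 heN)
      rw [h, card_empty] at this
      exact hk this.symm
    rw [card_union_of_disjoint hdis, ← card_sdiff_add_card_eq_card h₀]
    ring

theorem degree_pair_le [Fintype V] (H : KGraph V 3) {u v : V} (huv : u ≠ v) :
    H.degree {u, v} ≤ (univ.filter fun w => {u, v, w} ∈ H.edges).card := by
  refine (card_le_card ?_).trans
    (card_image_le (f := fun w => ({u, v, w} : Finset V)))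
  intro e he
  rw [mem_filter] at he
  have h1 : (e \ {u, v}).card = 1 := by
    rw [card_sdiff_of_subset he.2, H.uniform e he.1, card_pair huv]
  obtain ⟨w, hw⟩ := card_eq_one.1 h1
  have : ({u, v, w} : Finset V) = e := by
    rw [← union_sdiff_of_subset he.2, hw]
    ext; simp
  rw [mem_image]
  exact ⟨w, by simpa [this] using he.1, this⟩

theorem minDegree_le_degree_pair {k : ℕ} (H : KGraph V k) {u v : V} (huv : u ≠ v) :
    H.minDegree 2 ≤ H.degree {u, v} :=
  Nat.sInf_le ⟨{u, v}, card_pair huv, rfl⟩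

/-- Of the third vertices counted by the codegree of `u`, `v`, at most |U| lie outside the range of
`g`. -/
theorem le_sum_indicator_comp [Fintype V] (H : KGraph V 3) {T : Type*} [Fintype T] {g : T → V}
    (hg : g.Injective) {u v : V} (huv : u ≠ v) {U : Finset V} (hU : ∀ w, w ∉ U → ∃ a, g a = w) :
    (H.minDegree 2 : ℝ) - U.card ≤ ∑ a, H.indicator u v (g a) := by
  classical
  have h1 : ∑ a, H.indicator u v (g a) =
      (univ.filter fun a => {u, v, g a} ∈ H.edges).card := by
    simp [indicator]
  have h2 : (univ.filter fun w => {u, v, w} ∈ H.edges) ⊆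
      (univ.filter fun a => {u, v, g a} ∈ H.edges).image g ∪ U := by
    intro w hw
    rw [mem_union]
    by_contra! h
    obtain ⟨a, rfl⟩ := hU w h.2
    exact h.1 (mem_image_of_mem g (by simpa using hw))
  have h3 := ((H.minDegree_le_degree_pair huv).trans (H.degree_pair_le huv)).trans
    ((card_le_card h2).trans (card_union_le _ _))
  rw [card_image_of_injective _ hg] at h3
  rw [h1, sub_le_iff_le_add]
  exact_mod_cast h3

/-- The blocks of seven new edges, in terms of the six removed edges (each with its three vertices)
and three uncovered vertices: three edges through uncovered vertices and a Pasch configuration. -/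
def exchangeBlock : Fin 7 → Finset (Fin 6 × Fin 3 ⊕ Fin 3) :=
  ![{.inr 0, .inl (0, 0), .inl (1, 0)}, {.inr 1, .inl (2, 0), .inl (3, 0)},
    {.inr 2, .inl (4, 0), .inl (5, 0)}, {.inl (0, 1), .inl (2, 1), .inl (4, 1)},
    {.inl (0, 2), .inl (3, 1), .inl (5, 1)}, {.inl (1, 1), .inl (2, 2), .inl (5, 2)},
    {.inl (1, 2), .inl (3, 2), .inl (4, 2)}]

theorem disjoint_exchangeBlock : ∀ s t, s ≠ t → Disjoint (exchangeBlock s) (exchangeBlock t) := by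
  decide

/-- Shifting indices modulo 3 lists the vertices of each chosen edge starting from the labelled one.
As the six edges are distinct, this list is injective, so the seven blocks stay disjoint and meet no
other edge of `M`. -/
theorem IsMatching.exists_card_lt {H : KGraph V 3} {M : Finset (Finset V)} (hM : H.IsMatching M)
    {g : M × Fin 3 → V} (hg : g.Injective) (hgM : ∀ a, g a ∈ a.1.1)
    {u : Fin 3 → V} (hu : u.Injective) (huM : ∀ i, ∀ e ∈ M, u i ∉ e)
    {s : Fin 6 → M × Fin 3} (hs : Function.Injective fun k => (s k).1)
    (hH : ∀ t, (exchangeBlock t).image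
      (Sum.elim (fun kj => g ((s kj.1).1, (s kj.1).2 + kj.2)) u) ∈ H.edges) :
    ∃ M', H.IsMatching M' ∧ M.card < M'.card := by
  set Ψ : Fin 6 × Fin 3 ⊕ Fin 3 → V :=
    Sum.elim (fun kj => g ((s kj.1).1, (s kj.1).2 + kj.2)) u with hΨ
  have hinj : Ψ.Injective := by
    refine Function.Injective.sumElim ?_ hu ?_
    · rintro ⟨k, j⟩ ⟨k', j'⟩ h
      have h' := hg h
      simp only [Prod.mk.injEq] at h'
      obtain rfl := hs h'.1
      rw [add_left_cancel h'.2]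
    · intro kj i h
      exact huM i _ (s kj.1).1.2 (h ▸ hgM _)
  have hdis : ∀ t t', t ≠ t' → Disjoint ((exchangeBlock t).image Ψ)
      ((exchangeBlock t').image Ψ) := fun t t' h =>
    (disjoint_image hinj).2 (disjoint_exchangeBlock t t' h)
  have hbinj : Function.Injective fun t => (exchangeBlock t).image Ψ := by
    intro t t' h
    by_contra hne
    have h1 := hdis t t' hne
    have h' : (exchangeBlock t).image Ψ = (exchangeBlock t').image Ψ := h
    rw [h', disjoint_self, bot_eq_empty] at h1
    have := H.uniform _ (hH t')
    rw [h1] at this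
    simp at this
  have hM₀ : (univ.image fun k => (s k).1.1) ⊆ M := by
    intro e he
    obtain ⟨k, -, rfl⟩ := mem_image.1 he
    exact (s k).1.2
  have hN : H.IsMatching (univ.image fun t => (exchangeBlock t).image Ψ) := by
    refine ⟨fun e he => ?_, fun e he f hf hef => ?_⟩
    · obtain ⟨t, -, rfl⟩ := mem_image.1 he
      exact hH t
    · obtain ⟨t, -, rfl⟩ := mem_image.1 he
      obtain ⟨t', -, rfl⟩ := mem_image.1 hf
      exact hdis t t' fun h => hef (by rw [h])
  obtain ⟨M', hM', hc⟩ := hM.exists_exchange three_ne_zero hM₀ hN fun e he f hf hf₀ => by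
    obtain ⟨t, -, rfl⟩ := mem_image.1 he
    rw [Finset.disjoint_left]
    intro v hv hvf
    obtain ⟨x, -, rfl⟩ := mem_image.1 hv
    rcases x with kj | i
    · refine hf₀ (mem_image.2 ⟨kj.1, mem_univ _, ?_⟩)
      by_contra hne
      exact Finset.disjoint_left.1 (hM.2 _ (s kj.1).1.2 f hf hne)
        (hgM ((s kj.1).1, (s kj.1).2 + kj.2)) hvf
    · exact huM i f hf hvf
  refine ⟨M', hM', ?_⟩
  have h1 : (univ.image fun t => (exchangeBlock t).image Ψ).card = 7 := by
    rw [card_image_of_injective _ hbinj]; simp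
  have h2 : (univ.image fun k => (s k).1.1).card ≤ 6 := card_image_le.trans_eq (by simp)
  omega

/-- A labelling of the vertices that a matching covers. -/
theorem IsMatching.exists_labelling {H : KGraph V 3} {M : Finset (Finset V)}
    (hM : H.IsMatching M) : ∃ g : M × Fin 3 → V, g.Injective ∧ (∀ a, g a ∈ a.1.1) ∧
      ∀ e ∈ M, ∀ v ∈ e, ∃ a, g a = v := by
  let E : ∀ e : M, e.1 ≃ Fin 3 := fun e => Finset.equivFinOfCardEq (H.uniform e.1 (hM.1 e.2))
  refine ⟨fun a => (E a.1).symm a.2, ?_, fun a => ((E a.1).symm a.2).2,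
    fun e he v hv => ⟨(⟨e, he⟩, E ⟨e, he⟩ ⟨v, hv⟩), by simp⟩⟩
  rintro ⟨e, i⟩ ⟨f, j⟩ h
  have hef : e = f := by
    by_contra hne
    refine Finset.disjoint_left.1 (hM.2 e.1 e.2 f.1 f.2 fun h => hne (Subtype.ext h))
      ((E e).symm i).2 ?_
    have h' : ((E e).symm i : V) = (E f).symm j := h
    rw [h']
    exact ((E f).symm j).2
  subst hef
  exact Prod.ext rfl ((E e).symm.injective (Subtype.ext h))

end KGraph

/-! ### The choice of constants. -/

/-- Here s = √n, Λ = λ₂, q is the ordered density and u = |U|. The two conclusions are the smallness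
of `U` and the count needed for the exchange. -/
theorem matching_numerics {α γ p n q Λ u s : ℝ} (hα : 0 < α) (hγ₁ : γ ≤ 1 / 2)
    (hγ₂ : γ ≤ α ^ 3 / 1024) (hγ : 0 < γ) (hp : 0 < p) (hp₁ : p ≤ 1) (hs : 0 < s)
    (hn : n = s ^ 2) (hsα : (23040 / α ^ 3) ^ 2 < s) (hq : p / 2 ≤ q)
    (hΛ : Λ ≤ γ * p ^ 15 * s ^ 3) (hΛ' : 1 / 2 ≤ Λ) (hU : q ^ 2 * u ^ 3 ≤ Λ ^ 2) :
    u ≤ α * p * n / 4 ∧ 90 * n ^ 5 < q ^ 4 * (α * p * n ^ 2 / 2) ^ 3 - 4 * (n ^ 3 * (Λ * s ^ 3)) := by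
  have hn0 : 0 < n := by rw [hn]; positivity
  have hs6 : s ^ 3 * s ^ 3 = n ^ 3 := by rw [hn]; ring
  constructor
  · by_contra! h
    have h1 : (p / 2) ^ 2 * (α * p * n / 4) ^ 3 ≤ q ^ 2 * u ^ 3 := by gcongr
    have h2 : Λ ^ 2 ≤ (γ * p ^ 15 * s ^ 3) ^ 2 := by gcongr
    have h3 : (γ * p ^ 15 * s ^ 3) ^ 2 = γ ^ 2 * n ^ 3 * p ^ 5 * p ^ 25 := by
      rw [← hs6]; ring
    have h4 : γ ^ 2 * n ^ 3 * p ^ 5 * p ^ 25 ≤ γ ^ 2 * n ^ 3 * p ^ 5 :=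
      mul_le_of_le_one_right (by positivity) (pow_le_one₀ hp.le hp₁)
    have h5 : γ ^ 2 ≤ α ^ 3 / 1024 * (1 / 2) := by
      rw [sq]; gcongr
    have h6 : γ ^ 2 * (n ^ 3 * p ^ 5) ≤ α ^ 3 / 1024 * (1 / 2) * (n ^ 3 * p ^ 5) := by gcongr
    have h7 : 0 < α ^ 3 * (n ^ 3 * p ^ 5) := by positivity
    nlinarith
  · have h1 : (p / 2) ^ 4 * (α * p * n ^ 2 / 2) ^ 3 ≤ q ^ 4 * (α * p * n ^ 2 / 2) ^ 3 := by gcongr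
    have h2 : n ^ 3 * (Λ * s ^ 3) ≤ n ^ 3 * ((γ * p ^ 15 * s ^ 3) * s ^ 3) := by gcongr
    have h3 : n ^ 3 * ((γ * p ^ 15 * s ^ 3) * s ^ 3) = γ * (n ^ 6 * p ^ 7) * p ^ 8 := by
      rw [mul_assoc (γ * p ^ 15), hs6]; ring
    have h4 : γ * (n ^ 6 * p ^ 7) * p ^ 8 ≤ γ * (n ^ 6 * p ^ 7) :=
      mul_le_of_le_one_right (by positivity) (pow_le_one₀ hp.le hp₁)
    have h5 : γ * (n ^ 6 * p ^ 7) ≤ α ^ 3 / 1024 * (n ^ 6 * p ^ 7) := by gcongr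
    -- From 1/2 ≤ Λ ≤ γp¹⁵s³ with γ ≤ 1/2; multiplying by s gives (p⁷n)² ≥ s, which is how p⁷n
    -- becomes large.
    have h6 : 1 ≤ p ^ 14 * s ^ 3 := by
      have h : γ * p ^ 15 * s ^ 3 ≤ 1 / 2 * (p ^ 14 * s ^ 3) := by
        have : p ^ 15 ≤ p ^ 14 := pow_le_pow_of_le_one hp.le hp₁ (by norm_num)
        calc γ * p ^ 15 * s ^ 3 ≤ 1 / 2 * p ^ 14 * s ^ 3 := by gcongr
          _ = _ := by ring
      linarith
    have h7 : s ≤ (p ^ 7 * n) ^ 2 := by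
      calc s ≤ s * (p ^ 14 * s ^ 3) := le_mul_of_one_le_right hs.le h6
        _ = _ := by rw [hn]; ring
    -- The main term is at least α³p⁷n⁶/128 and the spectral error takes at most half of it. The
    -- remaining α³p⁷n⁶/256 must beat 90n⁵, and 23040 = 90 · 256.
    have h8 : 23040 / α ^ 3 < p ^ 7 * n := lt_of_pow_lt_pow_left₀ 2 (by positivity) (hsα.trans_le h7)
    rw [div_lt_iff₀ (by positivity)] at h8
    have h9 : 23040 * n ^ 5 < p ^ 7 * n * α ^ 3 * n ^ 5 := by gcongr
    nlinarith

/-! ### Enlarging a matching that misses three vertices. -/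

namespace KGraph

variable {V : Type*} [Fintype V] [DecidableEq V]

omit [DecidableEq V] in
theorem card_edges_le_choose (H : KGraph V 3) : H.edges.card ≤ (Fintype.card V).choose 3 := by
  rw [← card_univ, ← card_powersetCard]
  exact card_le_card fun e he => mem_powersetCard.2 ⟨subset_univ _, H.uniform e he⟩

omit [DecidableEq V] in
theorem density_eq (H : KGraph V 3) (hn : 3 ≤ Fintype.card V) :
    H.density = (H.edges.card : ℝ) / ((Fintype.card V).choose 3 : ℝ) *
      ((1 - 1 / (Fintype.card V : ℝ)) * (1 - 2 / (Fintype.card V : ℝ))) := by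
  unfold density
  have h0 : (0 : ℝ) < (Fintype.card V).choose 3 := by exact_mod_cast Nat.choose_pos hn
  have hc : (6 : ℝ) * ((Fintype.card V).choose 3 : ℝ) =
      (Fintype.card V : ℝ) * ((Fintype.card V : ℝ) - 1) * ((Fintype.card V : ℝ) - 2) := by
    obtain ⟨m, hm⟩ := Nat.exists_eq_add_of_le hn
    have h := Nat.descFactorial_eq_factorial_mul_choose (Fintype.card V) 3
    rw [hm] at h ⊢
    simp only [Nat.descFactorial, Nat.factorial] at h
    have h' : (3 + m - 2) * ((3 + m - 1) * (3 + m)) = 6 * (3 + m).choose 3 := by simpa using h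
    rw [show 3 + m - 2 = m + 1 by omega, show 3 + m - 1 = m + 2 by omega] at h'
    have h'' : ((m : ℝ) + 1) * ((m + 2) * (3 + m)) = 6 * ((3 + m).choose 3 : ℝ) := by
      exact_mod_cast h'
    rw [← h'']; push_cast; ring
  have hn0 : (0 : ℝ) < Fintype.card V := by exact_mod_cast (by omega : 0 < Fintype.card V)
  generalize (Fintype.card V : ℝ) = n at *
  generalize ((Fintype.card V).choose 3 : ℝ) = c at *
  have h1 : (1 - 1 / n) * (1 - 2 / n) = 6 * c / n ^ 3 := by
    rw [hc]; field_simp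
  rw [h1, show ((3 : ℕ).factorial : ℝ) = 6 by norm_num [Nat.factorial]]
  field_simp

omit [Fintype V] in
theorem abs_indicator_le_one (H : KGraph V 3) (u v w : V) : |H.indicator u v w| ≤ 1 :=
  abs_le.2 ⟨by linarith [H.indicator_nonneg u v w], H.indicator_le_one u v w⟩

/-- A matching that leaves three vertices uncovered can be enlarged as soon as Pasch configurations
on the labelled matching edges are more frequent than degenerate ones. -/
theorem IsMatching.exists_card_lt_of_count {H : KGraph V 3} {M : Finset (Finset V)}
    (hM : H.IsMatching M) {U : Finset V} (hU : ∀ v, v ∈ U ↔ ∀ e ∈ M, v ∉ e)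
    {u : Fin 3 → V} (hu : u.Injective) (huU : ∀ i, u i ∈ U) (hq : H.density ≤ 1)
    {d : ℝ} (hd : 0 ≤ d) (hd' : d ≤ ((Fintype.card V : ℝ) - U.card) * (H.minDegree 2 - U.card))
    (hcount : 90 * (Fintype.card V : ℝ) ^ 5 < H.density ^ 4 * d ^ 3 -
      4 * ((Fintype.card V : ℝ) ^ 3 * (H.eigTwo * √(Fintype.card V) ^ 3))) :
    ∃ M', H.IsMatching M' ∧ M.card < M'.card := by
  obtain ⟨g, hg, hgM, hgs⟩ := hM.exists_labelling
  have huM : ∀ i, ∀ e ∈ M, u i ∉ e := fun i => (hU _).1 (huU i)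
  have hsurj : ∀ w, w ∉ U → ∃ a, g a = w := fun w hw => by
    rw [hU] at hw
    push Not at hw
    obtain ⟨e, he, hwe⟩ := hw
    exact hgs e he w hwe
  have hT : Fintype.card (M × Fin 3) ≤ Fintype.card V := Fintype.card_le_of_injective g hg
  have hT' : (Fintype.card V : ℝ) - U.card ≤ Fintype.card (M × Fin 3) := by
    rw [sub_le_iff_le_add]
    have h1 : (univ : Finset V) ⊆ univ.image g ∪ U := fun w _ => by
      rw [mem_union]
      by_contra! h
      obtain ⟨a, rfl⟩ := hsurj w h.2
      exact h.1 (mem_image_of_mem g (mem_univ a))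
    have h2 := (card_le_card h1).trans (card_union_le _ _)
    rw [card_image_of_injective _ hg, card_univ, card_univ] at h2
    exact_mod_cast h2
  have hL : ∀ i, d ≤ ∑ a, ∑ b, H.indicator (u i) (g a) (g b) := fun i => by
    rcases le_or_gt 0 ((H.minDegree 2 : ℝ) - U.card) with h0 | h0
    · calc d ≤ _ := hd'
        _ ≤ (Fintype.card (M × Fin 3) : ℝ) * (H.minDegree 2 - U.card) := by gcongr
        _ = ∑ _a : M × Fin 3, ((H.minDegree 2 : ℝ) - U.card) := by
            rw [sum_const, nsmul_eq_mul, card_univ]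
        _ ≤ _ := sum_le_sum fun a _ => H.le_sum_indicator_comp hg
            (fun h : u i = g a => huM i _ a.1.2 (by rw [h]; exact hgM a)) hsurj
    -- If the minimum codegree is below |U|, the bound on `d` is nonpositive and the claim is
    -- trivial.
    · refine le_trans (hd'.trans (mul_nonpos_of_nonneg_of_nonpos ?_ h0.le))
        (sum_nonneg fun _ _ => sum_nonneg fun _ _ => H.indicator_nonneg _ _ _)
      rw [sub_nonneg]
      exact_mod_cast card_le_univ U
  -- The vertex `g a` goes with an uncovered vertex; `ρ 1 a` and `ρ 2 a` are the other two of its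
  -- edge, one for each Pasch line through that point, as in `exchangeBlock`.
  let ρ : Fin 3 → M × Fin 3 → V := fun j a => g (a.1, a.2 + j)
  have hρ : ∀ j, (ρ j).Injective := by
    rintro j ⟨e, i⟩ ⟨f, i'⟩ h
    have h' := hg h
    simp only [Prod.mk.injEq] at h'
    rw [h'.1, add_right_cancel h'.2]
  have hq0 : 0 ≤ H.density := by unfold density; positivity
  have hdev : ∀ i j k, ∀ f g h : M × Fin 3 → ℝ, (∀ a, |f a| ≤ 1) → (∀ a, |g a| ≤ 1) →
      (∀ a, |h a| ≤ 1) → |∑ a, ∑ b, ∑ c, (H.indicator (ρ i a) (ρ j b) (ρ k c) - H.density) *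
        (f a * g b * h c)| ≤ H.eigTwo * √(Fintype.card V) ^ 3 :=
    fun i j k f g h hf hg hh => H.abs_deviation_sum_comp_le (hρ i) (hρ j) (hρ k) hf hg hh
  have hle := H.abs_indicator_le_one
  have hP := le_sum_pasch (q := H.density) (L₁ := fun a b => H.indicator (u 0) (g a) (g b))
    (L₂ := fun a b => H.indicator (u 1) (g a) (g b))
    (L₃ := fun a b => H.indicator (u 2) (g a) (g b))
    (abs_le.2 ⟨by linarith, hq⟩) (hdev 1 1 1) (hdev 2 1 1) (hdev 1 2 2) (hdev 2 2 2)
    (fun _ _ _ => hle _ _ _) (fun _ _ _ => hle _ _ _) (fun _ _ _ => hle _ _ _)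
    (fun _ _ => hle _ _ _) (fun _ _ => hle _ _ _) (fun _ _ => hle _ _ _)
  have hE : 0 ≤ H.eigTwo * √(Fintype.card V) ^ 3 := mul_nonneg H.eigTwo_nonneg (by positivity)
  have hlow : H.density ^ 4 * d ^ 3 ≤ H.density ^ 4 *
      ((∑ a, ∑ b, H.indicator (u 0) (g a) (g b)) * (∑ a, ∑ b, H.indicator (u 1) (g a) (g b)) *
        (∑ a, ∑ b, H.indicator (u 2) (g a) (g b))) := by
    rw [pow_three, ← mul_assoc d]
    have h0 := hL 0
    have h1 := hL 1
    have h2 := hL 2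
    have h0' := hd.trans h0
    have h1' := hd.trans h1
    gcongr
  have hT3 : (Fintype.card (M × Fin 3) : ℝ) ^ 3 * (H.eigTwo * √(Fintype.card V) ^ 3) ≤
      (Fintype.card V : ℝ) ^ 3 * (H.eigTwo * √(Fintype.card V) ^ 3) := by gcongr
  have hT5 : (Fintype.card (M × Fin 3) : ℝ) ^ 5 ≤ (Fintype.card V : ℝ) ^ 5 := by gcongr
  have hw1 : ∀ x y z : (M × Fin 3) × (M × Fin 3),
      H.indicator (u 0) (g x.1) (g x.2) * H.indicator (u 1) (g y.1) (g y.2) *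
        H.indicator (u 2) (g z.1) (g z.2) *
        (H.indicator (ρ 1 x.1) (ρ 1 y.1) (ρ 1 z.1) * H.indicator (ρ 2 x.1) (ρ 1 y.2) (ρ 1 z.2) *
          H.indicator (ρ 1 x.2) (ρ 2 y.1) (ρ 2 z.2) *
          H.indicator (ρ 2 x.2) (ρ 2 y.2) (ρ 2 z.1)) ≤ 1 := fun x y z => by
    have h0 := H.indicator_nonneg
    have h1 := H.indicator_le_one
    refine mul_le_one₀ (mul_le_one₀ (mul_le_one₀ (h1 _ _ _) (h0 _ _ _) (h1 _ _ _)) (h0 _ _ _)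
      (h1 _ _ _)) ?_ (mul_le_one₀ (mul_le_one₀ (mul_le_one₀ (h1 _ _ _) (h0 _ _ _) (h1 _ _ _))
      (h0 _ _ _) (h1 _ _ _)) (h0 _ _ _) (h1 _ _ _))
    exact mul_nonneg (mul_nonneg (mul_nonneg (h0 _ _ _) (h0 _ _ _)) (h0 _ _ _)) (h0 _ _ _)
  obtain ⟨x, y, z, hw, hinj⟩ := exists_injective_fst_of_lt_sum (ι := M) hw1
    (lt_of_lt_of_le (by linarith) hP)
  simp only [mul_ne_zero_iff] at hw
  obtain ⟨⟨⟨h1, h2⟩, h3⟩, ⟨⟨hA, hB⟩, hC⟩, hD⟩ := hw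
  refine hM.exists_card_lt hg hgM hu huM hinj fun t => ?_
  fin_cases t
  · simpa [exchangeBlock] using mem_edges_of_indicator_ne_zero h1
  · simpa [exchangeBlock] using mem_edges_of_indicator_ne_zero h2
  · simpa [exchangeBlock] using mem_edges_of_indicator_ne_zero h3
  · simpa [exchangeBlock] using mem_edges_of_indicator_ne_zero hA
  · simpa [exchangeBlock] using mem_edges_of_indicator_ne_zero hB
  · simpa [exchangeBlock] using mem_edges_of_indicator_ne_zero hC
  · simpa [exchangeBlock] using mem_edges_of_indicator_ne_zero hD

omit [Fintype V] [DecidableEq V] in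
theorem exists_maximum_matching (H : KGraph V 3) :
    ∃ M, H.IsMatching M ∧ ∀ M', H.IsMatching M' → M'.card ≤ M.card := by
  classical
  obtain ⟨M, hM, hmax⟩ := exists_max_image (H.edges.powerset.filter H.IsMatching) card
    ⟨∅, by simp [IsMatching]⟩
  exact ⟨M, (mem_filter.1 hM).2, fun M' h => hmax M' (mem_filter.2 ⟨mem_powerset.2 h.1, h⟩)⟩

theorem IsMatching.three_dvd_card_uncovered {H : KGraph V 3} {M : Finset (Finset V)}
    (hM : H.IsMatching M) {U : Finset V} (hU : ∀ v, v ∈ U ↔ ∀ e ∈ M, v ∉ e)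
    (h3 : 3 ∣ Fintype.card V) : 3 ∣ U.card := by
  have h1 : Uᶜ = M.biUnion fun e => e := by
    ext v; simp [hU]
  have h2 : (Uᶜ).card = 3 * M.card := by
    rw [h1, card_biUnion fun e he f hf hef => hM.2 e he f hf hef,
      sum_const_nat fun e he => H.uniform e (hM.1 he), mul_comm]
  have := card_add_card_compl U
  omega

end KGraph

open KGraph in
theorem mainTheorem5 (α : ℝ) (hα : 0 < α) :
    ∃ (n₀ : ℕ) (γ : ℝ), 0 < γ ∧
      ∀ (V : Type*) [Fintype V] [DecidableEq V] (H : KGraph V 3) (n : ℕ) (p : ℝ),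
        Fintype.card V = n → 3 ∣ n → n₀ ≤ n → H.edges.Nonempty →
        p = (H.edges.card : ℝ) / (n.choose 3 : ℝ) →
        α * p * (n : ℝ) ≤ (H.minDegree 2 : ℝ) →
        (H.maxDegree 2 : ℝ) ≤ 1 / α * p * (n : ℝ) →
        H.eigTwo ≤ γ * p ^ 15 * H.eigOne →
        H.HasPerfectMatching := by
  -- The ceiling gives √n > (23040/α³)²; the summand 6 gives (1 − 1/n)(1 − 2/n) ≥ 1/2, hence q ≥
  -- p/2.
  refine ⟨⌈(23040 / α ^ 3) ^ 4⌉₊ + 6, min (1 / 2) (α ^ 3 / 1024), by positivity, ?_⟩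
  intro V _ _ H n p hn h3 hn₀ hne hp hδ _ hlam
  subst hn
  set γ : ℝ := min (1 / 2) (α ^ 3 / 1024)
  have hγ : 0 < γ := by positivity
  have hn6 : 6 ≤ Fintype.card V := by omega
  have hn6' : (6 : ℝ) ≤ Fintype.card V := by exact_mod_cast hn6
  have hchoose : (0 : ℝ) < (Fintype.card V).choose 3 := by
    exact_mod_cast Nat.choose_pos (by omega : 3 ≤ Fintype.card V)
  have hp0 : 0 < p := by
    rw [hp]; exact div_pos (by exact_mod_cast hne.card_pos) hchoose
  have hp1 : p ≤ 1 := by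
    rw [hp, div_le_one hchoose]; exact_mod_cast H.card_edges_le_choose
  have hq := H.density_eq (by omega)
  rw [← hp] at hq
  have hinv : 1 / (Fintype.card V : ℝ) ≤ 1 / 6 := one_div_le_one_div_of_le (by norm_num) hn6'
  have hinv0 : 0 ≤ 1 / (Fintype.card V : ℝ) := by positivity
  have h2inv : 2 / (Fintype.card V : ℝ) = 2 * (1 / (Fintype.card V : ℝ)) := by ring
  have hq2 : p / 2 ≤ H.density := by
    rw [hq, h2inv, div_eq_mul_inv]; gcongr; nlinarith
  have hq1 : H.density ≤ 1 := by
    rw [hq, h2inv]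
    refine mul_le_one₀ hp1 (mul_nonneg ?_ ?_) (mul_le_one₀ ?_ ?_ ?_) <;> linarith
  set s : ℝ := √(Fintype.card V) with hs
  have hs0 : 0 < s := Real.sqrt_pos.2 (by linarith)
  have hsn : (Fintype.card V : ℝ) = s ^ 2 := (Real.sq_sqrt (Nat.cast_nonneg _)).symm
  have hsα : (23040 / α ^ 3) ^ 2 < s := by
    refine Real.lt_sqrt_of_sq_lt ?_
    have h1 := Nat.le_ceil ((23040 / α ^ 3) ^ 4)
    have h2 : ((⌈(23040 / α ^ 3) ^ 4⌉₊ : ℝ) + 6) ≤ Fintype.card V := by exact_mod_cast hn₀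
    calc _ = (23040 / α ^ 3) ^ 4 := by ring
      _ < _ := by linarith
  have hΛ : H.eigTwo ≤ γ * p ^ 15 * s ^ 3 :=
    hlam.trans (mul_le_mul_of_nonneg_left H.eigOne_le (by positivity))
  obtain ⟨M, hM, hmax⟩ := H.exists_maximum_matching
  let U : Finset V := univ.filter fun v => ∀ e ∈ M, v ∉ e
  have hU : ∀ v, v ∈ U ↔ ∀ e ∈ M, v ∉ e := fun v => by simp [U]
  have hind : ∀ e ∈ H.edges, ¬ e ⊆ U := by
    intro e he heU
    have hdis : ∀ f ∈ M, Disjoint e f := fun f hf =>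
      Finset.disjoint_left.2 fun v hv => (hU v).1 (heU hv) f hf
    obtain ⟨M', hM', hc⟩ := hM.exists_exchange (M₀ := ∅) (N := {e}) three_ne_zero
      (empty_subset _) ⟨by simpa using he, by simp⟩ (by simpa using hdis)
    have := hmax M' hM'
    simp at hc
    omega
  obtain ⟨hUle, hcount⟩ := matching_numerics hα (min_le_left _ _) (min_le_right _ _) hγ hp0 hp1 hs0
    hsn hsα hq2 hΛ (half_le_eigTwo hne) (density_mul_card_pow_le hind)
  rcases U.eq_empty_or_nonempty with hU0 | hUne
  · refine ⟨M, hM.1, hM.2, fun v => ?_⟩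
    by_contra! h
    have := (hU v).2 h
    simp [hU0] at this
  · exfalso
    have hU3 : 3 ≤ U.card := by
      have := hM.three_dvd_card_uncovered hU h3
      have := hUne.card_pos
      omega
    obtain ⟨u⟩ := Function.Embedding.nonempty_of_card_le (α := Fin 3) (β := U) (by simpa using hU3)
    have hu : Function.Injective fun i => (u i : V) := Subtype.val_injective.comp u.injective
    have h01 : (u 0 : V) ≠ u 1 := hu.ne (by decide)
    -- With this, |U| ≤ αpn/4 also yields |U| ≤ n/4. Both factors of the pair count then keep 3/4 of
    -- their size, and (3/4)² ≥ 1/2.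
    have hαp : α * p ≤ 1 := by
      have h1 : (H.minDegree 2 : ℝ) ≤ Fintype.card V := by
        exact_mod_cast ((H.minDegree_le_degree_pair h01).trans
          (H.degree_pair_le h01)).trans (card_le_univ _)
      exact le_of_mul_le_mul_right (by linarith) (by linarith : (0 : ℝ) < Fintype.card V)
    have hd : α * p * (Fintype.card V : ℝ) ^ 2 / 2 ≤
        ((Fintype.card V : ℝ) - U.card) * (H.minDegree 2 - U.card) := by
      have h0 : α * p * (Fintype.card V : ℝ) ≤ Fintype.card V :=
        mul_le_of_le_one_left (Nat.cast_nonneg _) hαp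
      have h1 : (3 / 4 : ℝ) * Fintype.card V ≤ (Fintype.card V : ℝ) - U.card := by linarith
      have h2 : (3 / 4 : ℝ) * (α * p * Fintype.card V) ≤ (H.minDegree 2 : ℝ) - U.card := by
        linarith
      have h3 : 0 ≤ α * p * (Fintype.card V : ℝ) ^ 2 := by positivity
      calc _ ≤ (3 / 4 : ℝ) * Fintype.card V * ((3 / 4 : ℝ) * (α * p * Fintype.card V)) := by
            nlinarith
        _ ≤ _ := by gcongr; linarith
    obtain ⟨M', hM', hlt⟩ := hM.exists_card_lt_of_count hU hu (fun i => (u i).2) hq1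
      (by positivity) hd hcount
    exact (hmax M' hM').not_gt hlt
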